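/- Let $\Omega=(0,1)$, let $\lambda>0$, and let $f\colon(0,1)\to\mathbb R$ be measurable with $0\le f\le 1$ a.e. For $\varepsilon>0$ define $F_\varepsilon\colon (L^2(0,1))^3\to[0,+\infty]$ by $$F_\varepsilon(u,v_1,v_2)=|Du|(\Omega)+\frac1\varepsilon\bigl(|Dv_1|(\Omega)+|Dv_2|(\Omega)\bigr)+\lambda\int_0^1\bigl(u(v_1-f)^2+(1-u)(v_2-f)^2\bigr)\,dx+\int_0^1\mathbb I_{[0,1]}(u)\,dx,$$ where $|Dg|(\Omega)=\sup\{\int_0^1 g\varphi'\,dx:\varphi\in C^1_c(0,1),\ |\varphi|\le 1\}\in[0,+\infty]$ is the total variation (equal to $+\infty$ if $g\notin BV(0,1)$), $\mathbb I_{[0,1]}(t)=0$ for $t\in[0,1]$ and $\mathbb I_{[0,1]}(t)=+\infty$ otherwise, and $F_\varepsilon=+\infty$ whenever $u\notin[0,1]$ on a set of positive measure. Suppose that $0<\varepsilon<\frac{1}{4\lambda}$ and that $(u,v_1,v_2)\in (L^2(0,1))^3$ is a (global) minimizer of $F_\varepsilon$. Then $v_1$ and $v_2$ are (a.e. equal to)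 constants. Moreover, if $u$ is not a.e. equal to $0$, then $$v_1=\frac{\int_0^1 u f\,dx}{\int_0^1 u\,dx},$$ and if $u$ is not a.e. equal to $1$, then $$v_2=\frac{\int_0^1 (1-u) f\,dx}{\int_0^1 (1-u)\,dx}.$$ -/

import Mathlib

open MeasureTheory Set Filter
open scoped ENNReal

namespace Segmentation

/-- Lebesgue measure on the domain `Ω = (0,1)`. -/
noncomputable abbrev muΩ : Measure ℝ := volume.restrict (Ioo (0 : ℝ) 1)

/-- The space `L²(0,1)`. -/
abbrev L2Ω : Type := Lp ℝ 2 muΩ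

/-- The test fields for the total variation on `(0,1)`: functions in `C¹_c(0,1)` with `|φ| ≤ 1`. -/
def IsTestField (φ : ℝ → ℝ) : Prop :=
  ContDiff ℝ 1 φ ∧ HasCompactSupport φ ∧ tsupport φ ⊆ Ioo (0 : ℝ) 1 ∧ ∀ x, |φ x| ≤ 1

/-- The total variation `|Dg|(0,1) = sup { ∫ g φ' : φ ∈ C¹_c(0,1), |φ| ≤ 1 }`, which is `∞` exactly
when `g` is not of bounded variation on `(0,1)`. -/
noncomputable def totalVariation (g : L2Ω) : ℝ≥0∞ :=
  ⨆ (φ : ℝ → ℝ) (_ : IsTestField φ), ENNReal.ofReal (∫ x, g x * deriv φ x ∂muΩ)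

open Classical in
/-- The convex-analysis indicator function of `[0,1]`: `0` on `[0,1]` and `+∞` elsewhere. -/
noncomputable def indicator01 (t : ℝ) : ℝ≥0∞ := if t ∈ Icc (0 : ℝ) 1 then 0 else ⊤

/-- The augmented Lagrangian functional
`F_ε(u,v₁,v₂) = |Du| + (1/ε)(|Dv₁| + |Dv₂|) + λ ∫ (u (v₁ - f)² + (1-u) (v₂ - f)²) + ∫ I_[0,1](u)`
with values in `[0,∞]`. The fidelity integrand is nonnegative whenever `0 ≤ u ≤ 1` a.e.; in all
other cases the last term is `∞`, hence so is the functional. -/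
noncomputable def Feps (lam ε : ℝ) (f u v₁ v₂ : L2Ω) : ℝ≥0∞ :=
  totalVariation u + ENNReal.ofReal (1 / ε) * (totalVariation v₁ + totalVariation v₂)
    + ENNReal.ofReal lam *
        ∫⁻ x, ENNReal.ofReal (u x * (v₁ x - f x) ^ 2 + (1 - u x) * (v₂ x - f x) ^ 2) ∂muΩ
    + ∫⁻ x, indicator01 (u x) ∂muΩ

/-- `(u,v₁,v₂)` is a (global) minimizer of `F_ε` on `(L²(0,1))³`. -/
def IsMinimizer (lam ε : ℝ) (f u v₁ v₂ : L2Ω) : Prop :=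
  ∀ w w₁ w₂ : L2Ω, Feps lam ε f u v₁ v₂ ≤ Feps lam ε f w w₁ w₂

end Segmentation

namespace Segmentation

/-! With `u` fixed, each `vᵢ` beats every constant in a least-squares problem with weight `w = u` or
`w = 1 - u`, penalized by `1/ε` times the variation (`const_of_le_const`). Let `m` be the weighted
mean of `f`; then `h = w (f - m)` has mean zero and norm at most 1. Comparing `g = vᵢ` with `m` and
expanding squares gives `TV(g)/ε + λ ∫ w (m - g)² ≤ 2λ ∫ g h`. The duality bound `∫ g h ≤ ‖h‖ TV(g)`
(`inner_le_norm_mul_totalVariation`) makes the right side at most `2λ TV(g)`. Since `1/ε > 4λ`, both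
terms on the left vanish: `g` is constant, and equals `m` if `w ≠ 0`. -/

instance isProbabilityMeasure_muΩ : IsProbabilityMeasure muΩ := ⟨by simp [muΩ]⟩

/-! ### Continuous test functions and their density in `L²` -/

/-- Continuous functions with compact support in `(0,1)`. -/
def IsContinuousTest (k : ℝ → ℝ) : Prop :=
  Continuous k ∧ HasCompactSupport k ∧ tsupport k ⊆ Ioo (0 : ℝ) 1

lemma IsContinuousTest.add {k l : ℝ → ℝ} (hk : IsContinuousTest k) (hl : IsContinuousTest l) :
    IsContinuousTest (k + l) :=
  ⟨hk.1.add hl.1, hk.2.1.add hl.2.1, (tsupport_add k l).trans (union_subset hk.2.2 hl.2.2)⟩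

lemma IsContinuousTest.const_smul {k : ℝ → ℝ} (hk : IsContinuousTest k) (c : ℝ) :
    IsContinuousTest (c • k) :=
  ⟨hk.1.const_smul c, hk.2.1.smul_left (f := fun _ => c),
    (tsupport_smul_subset_right (fun _ => c) k).trans hk.2.2⟩

lemma IsContinuousTest.memLp {k : ℝ → ℝ} (hk : IsContinuousTest k) : MemLp k 2 muΩ :=
  (hk.1.memLp_of_hasCompactSupport hk.2.1).restrict _

/-- The classes in `L²(0,1)` of continuous functions with compact support in `(0,1)`. -/
def continuousTests : Submodule ℝ L2Ω where
  carrier := {h | ∃ k, IsContinuousTest k ∧ h =ᵐ[muΩ] k}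
  add_mem' := by
    rintro a b ⟨k, hk, hak⟩ ⟨l, hl, hbl⟩
    exact ⟨k + l, hk.add hl, (Lp.coeFn_add a b).trans (hak.add hbl)⟩
  zero_mem' := ⟨0, ⟨continuous_const, HasCompactSupport.zero, by simp [tsupport]⟩,
    Lp.coeFn_zero _ _ _⟩
  smul_mem' := by
    rintro c a ⟨k, hk, hak⟩
    exact ⟨c • k, hk.const_smul c, (Lp.coeFn_smul c a).trans (hak.const_smul c)⟩

lemma inner_eq_integral (g h : L2Ω) : inner ℝ g h = ∫ x, g x * h x ∂muΩ := by
  rw [L2.inner_def]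
  exact integral_congr_ae (.of_forall fun x => by simp [mul_comm])

/-- The orthogonal complement is trivial by the fundamental lemma of the calculus of variations. -/
lemma dense_continuousTests : Dense (continuousTests : Set L2Ω) := by
  rw [Submodule.dense_iff_topologicalClosure_eq_top, Submodule.topologicalClosure_eq_top_iff,
    Submodule.eq_bot_iff]
  intro h hh
  rw [Submodule.mem_orthogonal] at hh
  have hloc : LocallyIntegrableOn h (Ioo (0 : ℝ) 1) volume := by
    have : IntegrableOn h (Ioo (0 : ℝ) 1) volume := (Lp.memLp h).integrable (by norm_num)
    exact this.locallyIntegrableOn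
  have h0 := isOpen_Ioo.ae_eq_zero_of_integral_contDiff_smul_eq_zero hloc (fun k hk hc hs => by
    have hk' : IsContinuousTest k := ⟨hk.continuous, hc, hs⟩
    have hmem : hk'.memLp.toLp k ∈ continuousTests := ⟨k, hk', MemLp.coeFn_toLp _⟩
    have := hh _ hmem
    rw [inner_eq_integral] at this
    rw [← setIntegral_eq_integral_of_forall_compl_eq_zero (μ := volume) (s := Ioo (0 : ℝ) 1)
      (f := fun x => k x • h x)]
    · refine (integral_congr_ae ?_).trans this
      filter_upwards [hk'.memLp.coeFn_toLp] with x hx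
      rw [hx, smul_eq_mul]
    · intro x hx
      simp [image_eq_zero_of_notMem_tsupport (fun h => hx (hs h))])
  rw [Lp.eq_zero_iff_ae_eq_zero]
  exact (ae_restrict_iff' measurableSet_Ioo).2 h0

lemma integral_abs_le_norm (h : L2Ω) : ∫ x, |h x| ∂muΩ ≤ ‖h‖ := by
  have h1 : ∫ x, |h x| ∂muΩ = (eLpNorm h 1 muΩ).toReal := by
    rw [eLpNorm_one_eq_lintegral_enorm,
      ← integral_norm_eq_lintegral_enorm (Lp.aestronglyMeasurable h)]
    rfl
  rw [h1, Lp.norm_def]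
  exact ENNReal.toReal_mono (Lp.eLpNorm_ne_top h)
    (eLpNorm_le_eLpNorm_of_exponent_le (by norm_num) (Lp.aestronglyMeasurable h))

/-! ### Primitives of mean-zero functions and duality with the total variation -/

lemma exists_Icc_of_isCompact {K : Set ℝ} (hK : IsCompact K) (hs : K ⊆ Ioo (0 : ℝ) 1) :
    ∃ a b : ℝ, 0 < a ∧ b < 1 ∧ K ⊆ Icc a b := by
  rcases K.eq_empty_or_nonempty with rfl | hne
  · exact ⟨1 / 2, 1 / 2, by norm_num, by norm_num, empty_subset _⟩
  · obtain ⟨a, ha⟩ := hK.exists_isLeast hne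
    obtain ⟨b, hb⟩ := hK.exists_isGreatest hne
    exact ⟨a, b, (hs ha.1).1, (hs hb.1).2, fun x hx => ⟨ha.2 hx, hb.2 hx⟩⟩

lemma integral_muΩ_eq_intervalIntegral (k : ℝ → ℝ) : ∫ x, k x ∂muΩ = ∫ x in (0 : ℝ)..1, k x := by
  rw [intervalIntegral.integral_of_le zero_le_one, integral_Ioc_eq_integral_Ioo]

/-- A mean-zero continuous test function is the derivative of a `C¹_c` function, which is bounded
by the `L¹` norm of the derivative. -/
lemma IsContinuousTest.exists_primitive {k : ℝ → ℝ} (hk : IsContinuousTest k)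
    (hmean : ∫ x, k x ∂muΩ = 0) :
    ∃ φ : ℝ → ℝ, ContDiff ℝ 1 φ ∧ HasCompactSupport φ ∧ tsupport φ ⊆ Ioo (0 : ℝ) 1 ∧
      deriv φ = k ∧ ∀ x, |φ x| ≤ ∫ x, |k x| ∂muΩ := by
  obtain ⟨hc, hcs, hs⟩ := hk
  obtain ⟨a, b, ha, hb, hab⟩ := exists_Icc_of_isCompact hcs.isCompact hs
  have hzero : ∀ x ∉ Icc a b, k x = 0 := fun x hx =>
    image_eq_zero_of_notMem_tsupport fun h => hx (hab h)
  rw [integral_muΩ_eq_intervalIntegral] at hmean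
  set φ : ℝ → ℝ := fun x => ∫ t in (0 : ℝ)..x, k t with hφ
  have hderiv : ∀ x, HasDerivAt φ (k x) x := fun x => hc.integral_hasStrictDerivAt 0 x |>.hasDerivAt
  have hderiv' : deriv φ = k := funext fun x => (hderiv x).deriv
  have hsub : Function.support φ ⊆ Icc a b := by
    intro x hx
    by_contra hxab
    apply hx
    rcases lt_or_ge x a with h | h
    · refine intervalIntegral.integral_zero_ae (.of_forall fun t ht => hzero t fun h' => ?_)
      have := (mem_uIoc.1 ht)
      rcases this with h1 | h1 <;> linarith [h1.1, h1.2, h'.1]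
    -- To the right of the support, the primitive is the total integral minus the tail, and both
    -- vanish.
    · have hxb : b < x := lt_of_not_ge fun h' => hxab ⟨h, h'⟩
      have h1 : ∫ t in x..1, k t = 0 := by
        refine intervalIntegral.integral_zero_ae (.of_forall fun t ht => hzero t fun h' => ?_)
        have := (mem_uIoc.1 ht)
        rcases this with h1 | h1 <;> linarith [h1.1, h1.2, h'.2]
      have h2 := intervalIntegral.integral_add_adjacent_intervals (μ := volume)
        (hc.intervalIntegrable 0 x) (hc.intervalIntegrable x 1)
      simp only [hφ]
      linarith
  have hts : tsupport φ ⊆ Icc a b := closure_minimal hsub isClosed_Icc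
  have hts' : tsupport φ ⊆ Ioo (0 : ℝ) 1 :=
    hts.trans fun x hx => ⟨ha.trans_le hx.1, hx.2.trans_lt hb⟩
  refine ⟨φ, ?_, .of_support_subset_isCompact isCompact_Icc hsub, hts', hderiv', fun x => ?_⟩
  · rw [contDiff_one_iff_deriv, hderiv']
    exact ⟨fun x => (hderiv x).differentiableAt, hc⟩
  · rw [integral_muΩ_eq_intervalIntegral]
    have hnn : 0 ≤ ∫ x in (0 : ℝ)..1, |k x| :=
      intervalIntegral.integral_nonneg zero_le_one fun _ _ => abs_nonneg _
    by_cases hx : x ∈ tsupport φ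
    · have hx' := hts' hx
      calc |φ x| ≤ ∫ t in (0 : ℝ)..x, |k t| :=
            intervalIntegral.abs_integral_le_integral_abs hx'.1.le
        _ ≤ ∫ t in (0 : ℝ)..1, |k t| :=
            intervalIntegral.integral_mono_interval le_rfl hx'.1.le hx'.2.le
              (.of_forall fun _ => abs_nonneg _) (hc.abs.intervalIntegrable _ _)
    · rw [image_eq_zero_of_notMem_tsupport hx, abs_zero]
      exact hnn

lemma IsTestField.integral_mul_deriv_le {φ : ℝ → ℝ} (hφ : IsTestField φ) {g : L2Ω}
    (hg : totalVariation g ≠ ⊤) : ∫ x, g x * deriv φ x ∂muΩ ≤ (totalVariation g).toReal :=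
  (ENNReal.ofReal_le_iff_le_toReal hg).1
    (le_iSup₂ (f := fun φ (_ : IsTestField φ) => ENNReal.ofReal (∫ x, g x * deriv φ x ∂muΩ)) φ hφ)

/-- The primitive of the continuous representative is bounded by its `L¹` norm, hence by `‖h‖` on a
probability space, so dividing it by `‖h‖` gives an admissible test field. -/
lemma inner_le_of_mem_continuousTests {g h : L2Ω} (hg : totalVariation g ≠ ⊤)
    (hh : h ∈ continuousTests) (hmean : ∫ x, h x ∂muΩ = 0) :
    inner ℝ g h ≤ ‖h‖ * (totalVariation g).toReal := by
  obtain ⟨k, hk, hhk⟩ := hh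
  rcases eq_or_ne h 0 with rfl | hne
  · simp
  have hpos : 0 < ‖h‖ := norm_pos_iff.2 hne
  rw [integral_congr_ae hhk] at hmean
  obtain ⟨φ, hφ, hcs, hts, hd, hle⟩ := hk.exists_primitive hmean
  have hle' : ∀ x, |φ x| ≤ ‖h‖ := fun x => (hle x).trans <| by
    refine le_trans (le_of_eq ?_) (integral_abs_le_norm h)
    refine integral_congr_ae ?_
    filter_upwards [hhk] with x hx
    rw [hx]
  have htest : IsTestField (‖h‖⁻¹ • φ) := by
    refine ⟨by simpa only [Pi.smul_def] using hφ.const_smul ‖h‖⁻¹,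
      hcs.smul_left (f := fun _ => ‖h‖⁻¹),
      (tsupport_smul_subset_right (fun _ => ‖h‖⁻¹) φ).trans hts, fun x => ?_⟩
    rw [Pi.smul_apply, smul_eq_mul, abs_mul, abs_inv, abs_norm, inv_mul_le_iff₀ hpos, mul_one]
    exact hle' x
  have hint : ∫ x, g x * deriv (‖h‖⁻¹ • φ) x ∂muΩ = ‖h‖⁻¹ * inner ℝ g h := by
    rw [inner_eq_integral, ← integral_const_mul]
    refine integral_congr_ae ?_
    filter_upwards [hhk] with x hx
    rw [deriv_const_smul _ (hφ.differentiable one_ne_zero x), hd, hx, smul_eq_mul]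
    ring
  have := htest.integral_mul_deriv_le hg
  rwa [hint, inv_mul_le_iff₀ hpos] at this

/-- Used to correct the mean of a continuous test function without leaving the class. -/
lemma exists_continuousTests_integral_eq_one :
    ∃ η ∈ continuousTests, ∫ x, η x ∂muΩ = 1 := by
  let B : ContDiffBump (1 / 2 : ℝ) := ⟨1 / 8, 1 / 4, by norm_num, by norm_num⟩
  have hsub : tsupport (B.normed volume) ⊆ Ioo (0 : ℝ) 1 := by
    rw [B.tsupport_normed_eq, Real.closedBall_eq_Icc]
    intro x hx
    have h1 := hx.1
    have h2 := hx.2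
    norm_num [B] at h1 h2
    constructor <;> linarith
  have hk : IsContinuousTest (B.normed volume) :=
    ⟨B.continuous_normed, B.hasCompactSupport_normed, hsub⟩
  refine ⟨hk.memLp.toLp _, ⟨_, hk, MemLp.coeFn_toLp _⟩, ?_⟩
  rw [integral_congr_ae (MemLp.coeFn_toLp _), setIntegral_eq_integral_of_forall_compl_eq_zero]
  · exact B.integral_normed
  · exact fun x hx => image_eq_zero_of_notMem_tsupport fun h => hx (hsub h)

/-- The constant function `c` as an element of `L²(0,1)`. -/
noncomputable def constL2 (c : ℝ) : L2Ω := (memLp_const c).toLp fun _ => c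

lemma coeFn_constL2 (c : ℝ) : constL2 c =ᵐ[muΩ] fun _ => c := MemLp.coeFn_toLp _

lemma inner_constL2_one (h : L2Ω) : inner ℝ (constL2 1) h = ∫ x, h x ∂muΩ := by
  rw [inner_eq_integral]
  refine integral_congr_ae ?_
  filter_upwards [coeFn_constL2 1] with x hx
  rw [hx, one_mul]

/-- Pairing a function of bounded variation with a mean-zero `L²` function. -/
lemma inner_le_norm_mul_totalVariation {g h : L2Ω} (hg : totalVariation g ≠ ⊤)
    (hmean : ∫ x, h x ∂muΩ = 0) : inner ℝ g h ≤ ‖h‖ * (totalVariation g).toReal := by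
  obtain ⟨η, hη, hη1⟩ := exists_continuousTests_integral_eq_one
  -- `P` makes the mean zero, preserves continuous tests and fixes mean-zero functions, so the bound
  -- passes from the dense class to all of `L²`.
  let P : L2Ω → L2Ω := fun k => k - (inner ℝ (constL2 1) k : ℝ) • η
  have hP : Continuous P := by fun_prop
  have hcl : IsClosed {k : L2Ω | inner ℝ g (P k) ≤ ‖P k‖ * (totalVariation g).toReal} :=
    isClosed_le (by fun_prop) (by fun_prop)
  have hall : ∀ k : L2Ω, inner ℝ g (P k) ≤ ‖P k‖ * (totalVariation g).toReal := by
    intro k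
    refine hcl.closure_subset_iff.2 ?_ (dense_continuousTests k)
    intro k hk
    refine inner_le_of_mem_continuousTests hg
      (continuousTests.sub_mem hk (continuousTests.smul_mem _ hη)) ?_
    rw [← inner_constL2_one, inner_sub_right, inner_smul_right, inner_constL2_one η, hη1]
    simp
  have := hall h
  simpa [P, inner_constL2_one, hmean] using this

lemma totalVariation_constL2 (c : ℝ) : totalVariation (constL2 c) = 0 := by
  simp only [totalVariation, ENNReal.iSup_eq_zero]
  intro φ hφ
  have : ∫ x, constL2 c x * deriv φ x ∂muΩ = 0 := by
    have h1 : ∫ x, constL2 c x * deriv φ x ∂muΩ = ∫ x, c * deriv φ x ∂muΩ := by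
      refine integral_congr_ae ?_
      filter_upwards [coeFn_constL2 c] with x hx
      rw [hx]
    rw [h1, integral_const_mul, integral_muΩ_eq_intervalIntegral,
      intervalIntegral.integral_deriv_eq_sub
        (fun x _ => hφ.1.differentiable one_ne_zero x)
        ((hφ.1.continuous_deriv le_rfl).intervalIntegrable _ _),
      image_eq_zero_of_notMem_tsupport fun h => (hφ.2.2.1 h).1.false,
      image_eq_zero_of_notMem_tsupport fun h => (hφ.2.2.1 h).2.false]
    simp
  simp [this]

/-- Duality tested on `g` minus its mean `c` gives `‖g - c‖² = ⟪g, g - c⟫ ≤ 0`. -/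
lemma ae_eq_const_of_totalVariation_eq_zero {g : L2Ω} (hg : totalVariation g = 0) :
    ∃ c : ℝ, ∀ᵐ x ∂muΩ, g x = c := by
  set c := ∫ x, g x ∂muΩ with hc
  have hmean : ∀ b, inner ℝ (constL2 b) (g - constL2 c) = 0 := by
    intro b
    have hb : constL2 b = b • constL2 1 := by
      apply Lp.ext
      filter_upwards [coeFn_constL2 b, coeFn_constL2 1, Lp.coeFn_smul b (constL2 1)] with x h1 h2 h3
      rw [h1, h3, Pi.smul_apply, h2, smul_eq_mul, mul_one]
    rw [hb, inner_smul_left, inner_sub_right, inner_constL2_one, inner_constL2_one,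
      integral_congr_ae (coeFn_constL2 c)]
    simp [hc]
  have h1 := inner_le_norm_mul_totalVariation (g := g) (h := g - constL2 c) (by simp [hg])
    (by rw [← inner_constL2_one, hmean])
  have h2 : inner ℝ (g - constL2 c) (g - constL2 c) ≤ (0 : ℝ) := by
    rw [inner_sub_left, hmean]
    simpa [hg] using h1
  have h3 : g = constL2 c := sub_eq_zero.1 (real_inner_self_nonpos.1 h2)
  refine ⟨c, ?_⟩
  filter_upwards [coeFn_constL2 c] with x hx
  rw [h3, hx]

/-! ### The penalized weighted least-squares problem -/

lemma integrable_weight_mul {w : ℝ → ℝ} (hw : AEStronglyMeasurable w muΩ)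
    (hw01 : ∀ᵐ x ∂muΩ, w x ∈ Icc (0 : ℝ) 1) {p : ℝ → ℝ} (hp : Integrable p muΩ) :
    Integrable (fun x => w x * p x) muΩ := by
  refine hp.bdd_mul (c := 1) hw ?_
  filter_upwards [hw01] with x hx
  rw [Real.norm_eq_abs, abs_of_nonneg hx.1]
  exact hx.2

lemma integrable_sub_sq (g f : L2Ω) : Integrable (fun x => (g x - f x) ^ 2) muΩ :=
  ((Lp.memLp g).sub (Lp.memLp f)).integrable_sq

lemma integrable_const_sub_sq (c : ℝ) (f : L2Ω) : Integrable (fun x => (c - f x) ^ 2) muΩ :=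
  ((memLp_const c).sub (Lp.memLp f)).integrable_sq

/-- A function that beats all constants in the weighted least-squares problem penalized by the total
variation is constant, and equal to the weighted mean of the datum. -/
lemma const_of_le_const {lam ε : ℝ} (hlam : 0 < lam) (hε : 0 < ε) (hsmall : ε < 1 / (4 * lam))
    {w : ℝ → ℝ} (hw : AEStronglyMeasurable w muΩ) (hw01 : ∀ᵐ x ∂muΩ, w x ∈ Icc (0 : ℝ) 1)
    {f g : L2Ω} (hf : ∀ᵐ x ∂muΩ, f x ∈ Icc (0 : ℝ) 1) (hg : totalVariation g ≠ ⊤)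
    (hmin : ∀ c : ℝ, 1 / ε * (totalVariation g).toReal + lam * ∫ x, w x * (g x - f x) ^ 2 ∂muΩ
      ≤ lam * ∫ x, w x * (c - f x) ^ 2 ∂muΩ) :
    ∃ c : ℝ, (∀ᵐ x ∂muΩ, g x = c) ∧
      (¬ (∀ᵐ x ∂muΩ, w x = 0) → c = (∫ x, w x * f x ∂muΩ) / ∫ x, w x ∂muΩ) := by
  have hε4 : 4 * lam < 1 / ε := by
    rw [lt_div_iff₀ (by positivity)] at hsmall
    rw [lt_div_iff₀ hε]
    linarith
  set T := (totalVariation g).toReal with hT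
  have hT0 : 0 ≤ T := ENNReal.toReal_nonneg
  have hzero : T = 0 → totalVariation g = 0 := fun h =>
    ((ENNReal.toReal_eq_zero_iff _).1 h).resolve_right hg
  by_cases hw0 : ∀ᵐ x ∂muΩ, w x = 0
  · have hnull : ∀ p : ℝ → ℝ, ∫ x, w x * p x ∂muΩ = 0 := fun p => by
      refine integral_eq_zero_of_ae ?_
      filter_upwards [hw0] with x hx
      simp [hx]
    -- With zero weight the fidelity vanishes, so any constant forces zero variation.
    have h0 := hmin 0
    rw [hnull, hnull] at h0
    obtain ⟨c, hc⟩ := ae_eq_const_of_totalVariation_eq_zero (hzero (by nlinarith))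
    exact ⟨c, hc, fun h => absurd hw0 h⟩
  have hfint : Integrable f muΩ := (Lp.memLp f).integrable (by norm_num)
  have hwint : Integrable w muΩ := by
    simpa using integrable_weight_mul hw hw01 (integrable_const (1 : ℝ))
  have hwf := integrable_weight_mul hw hw01 hfint
  set W := ∫ x, w x ∂muΩ with hW
  have hwnn : 0 ≤ᵐ[muΩ] w := hw01.mono fun x hx => hx.1
  have hWpos : 0 < W := by
    refine lt_of_le_of_ne (integral_nonneg_of_ae hwnn) fun h => hw0 ?_
    exact (integral_eq_zero_iff_of_nonneg_ae hwnn hwint).1 h.symm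
  set m := (∫ x, w x * f x ∂muΩ) / W with hm
  have hm0 : 0 ≤ m := by
    refine div_nonneg (integral_nonneg_of_ae ?_) hWpos.le
    filter_upwards [hw01, hf] with x h1 h2 using mul_nonneg h1.1 h2.1
  have hm1 : m ≤ 1 := by
    rw [hm, div_le_one hWpos]
    refine integral_mono_ae hwf hwint ?_
    filter_upwards [hw01, hf] with x h1 h2 using mul_le_of_le_one_right h1.1 h2.2
  have hbound : ∀ᵐ x ∂muΩ, ‖w x * (f x - m)‖ ≤ 1 := by
    filter_upwards [hw01, hf] with x h1 h2
    rw [Real.norm_eq_abs, abs_mul]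
    refine mul_le_one₀ ?_ (abs_nonneg _) ?_ <;> rw [abs_le] <;>
      constructor <;> linarith [h1.1, h1.2, h2.1, h2.2]
  have hhm : MemLp (fun x => w x * (f x - m)) 2 muΩ :=
    MemLp.of_bound (hw.mul (hfint.aestronglyMeasurable.sub aestronglyMeasurable_const)) 1 hbound
  set h : L2Ω := hhm.toLp _ with hh
  have hcoe : h =ᵐ[muΩ] fun x => w x * (f x - m) := hhm.coeFn_toLp
  have hnorm : ‖h‖ ≤ 1 := by
    have := Lp.norm_le_of_ae_bound (f := h) zero_le_one (by
      filter_upwards [hcoe, hbound] with x h1 h2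
      rwa [h1])
    simpa [measureUnivNNReal] using this
  have hmean : ∫ x, h x ∂muΩ = 0 := by
    have : ∫ x, h x ∂muΩ = ∫ x, (w x * f x - w x * m) ∂muΩ := by
      refine integral_congr_ae ?_
      filter_upwards [hcoe] with x hx
      rw [hx]
      ring
    rw [this, integral_sub hwf (hwint.mul_const m), integral_mul_const, ← hW, hm]
    field_simp
    ring
  have hpair := inner_le_norm_mul_totalVariation hg hmean
  rw [inner_eq_integral] at hpair
  have hpair' : ∫ x, g x * h x ∂muΩ ≤ T :=
    hpair.trans (mul_le_of_le_one_left hT0 hnorm)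
  have hQint := integrable_weight_mul hw hw01 (p := fun x => (m - g x) ^ 2)
    (integrable_const_sub_sq m g)
  set Q := ∫ x, w x * (m - g x) ^ 2 ∂muΩ with hQ
  have hQ0 : 0 ≤ Q := by
    refine integral_nonneg_of_ae ?_
    filter_upwards [hw01] with x hx using mul_nonneg hx.1 (sq_nonneg _)
  have hghint : Integrable (fun x => g x * h x) muΩ := (Lp.memLp g).integrable_mul (Lp.memLp h)
  -- Pointwise expansion of the squares; the leftover term `2 m h` integrates to zero.
  have hexp : ∫ x, w x * (m - f x) ^ 2 ∂muΩ
      = ∫ x, w x * (g x - f x) ^ 2 ∂muΩ + 2 * ∫ x, g x * h x ∂muΩ - Q := by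
    have h1 : ∫ x, w x * (m - f x) ^ 2 ∂muΩ = ∫ x, ((w x * (g x - f x) ^ 2 + 2 * (g x * h x)
        - w x * (m - g x) ^ 2) - 2 * m * h x) ∂muΩ := by
      refine integral_congr_ae ?_
      filter_upwards [hcoe] with x hx
      rw [hx]
      ring
    have hA := integrable_weight_mul hw hw01 (integrable_sub_sq g f)
    have hAB : Integrable (fun x => w x * (g x - f x) ^ 2 + 2 * (g x * h x)) muΩ :=
      hA.add (hghint.const_mul 2)
    have hABQ : Integrable (fun x => w x * (g x - f x) ^ 2 + 2 * (g x * h x)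
        - w x * (m - g x) ^ 2) muΩ := hAB.sub hQint
    rw [h1, integral_sub hABQ
        (((Lp.memLp h).integrable (by norm_num)).const_mul _),
      integral_sub hAB hQint, integral_add hA (hghint.const_mul 2),
      integral_const_mul, integral_const_mul, hmean]
    ring
  have hm' := hmin m
  rw [hexp] at hm'
  -- Here `2λ < 1/ε` already forces `T = 0`, and then `Q = 0`.
  have hkey : 1 / ε * T + lam * Q ≤ 2 * lam * T := by nlinarith
  have hlamQ : 0 ≤ lam * Q := by positivity
  have hT' : T = 0 := by nlinarith
  have hQ' : Q = 0 := by
    rw [hT'] at hkey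
    nlinarith
  obtain ⟨c, hc⟩ := ae_eq_const_of_totalVariation_eq_zero (hzero hT')
  refine ⟨c, hc, fun _ => ?_⟩
  have : Q = W * (m - c) ^ 2 := by
    rw [hQ, hW, ← integral_mul_const]
    refine integral_congr_ae ?_
    filter_upwards [hc] with x hx
    rw [hx]
  rw [hQ', eq_comm, mul_eq_zero, or_iff_right hWpos.ne', sq_eq_zero_iff] at this
  linarith

/-! ### Reduction from the functional to real inequalities -/

/-- The fidelity term of the functional. -/
noncomputable def fidelity (f u v₁ v₂ : L2Ω) : ℝ :=
  ∫ x, u x * (v₁ x - f x) ^ 2 ∂muΩ + ∫ x, (1 - u x) * (v₂ x - f x) ^ 2 ∂muΩ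

lemma one_sub_mem_Icc {u : ℝ → ℝ} (hu : ∀ᵐ x ∂muΩ, u x ∈ Icc (0 : ℝ) 1) :
    ∀ᵐ x ∂muΩ, 1 - u x ∈ Icc (0 : ℝ) 1 :=
  hu.mono fun x hx => ⟨by linarith [hx.2], by linarith [hx.1]⟩

lemma fidelity_nonneg (f : L2Ω) {u : L2Ω} (hu : ∀ᵐ x ∂muΩ, u x ∈ Icc (0 : ℝ) 1) (v₁ v₂ : L2Ω) :
    0 ≤ fidelity f u v₁ v₂ := by
  refine add_nonneg (integral_nonneg_of_ae ?_) (integral_nonneg_of_ae ?_)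
  · filter_upwards [hu] with x hx using mul_nonneg hx.1 (sq_nonneg _)
  · filter_upwards [one_sub_mem_Icc hu] with x hx using mul_nonneg hx.1 (sq_nonneg _)

lemma Feps_eq (lam ε : ℝ) (hlam : 0 ≤ lam) (f : L2Ω) {u : L2Ω}
    (hu : ∀ᵐ x ∂muΩ, u x ∈ Icc (0 : ℝ) 1) (v₁ v₂ : L2Ω) :
    Feps lam ε f u v₁ v₂ = totalVariation u
      + ENNReal.ofReal (1 / ε) * (totalVariation v₁ + totalVariation v₂)
      + ENNReal.ofReal (lam * fidelity f u v₁ v₂) := by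
  have hu' := one_sub_mem_Icc hu
  have hm := Lp.aestronglyMeasurable u
  have hI : ∫⁻ x, indicator01 (u x) ∂muΩ = 0 := by
    rw [lintegral_congr_ae (g := fun _ => 0), lintegral_zero]
    filter_upwards [hu] with x hx
    simp only [indicator01, if_pos hx]
  have h1 := integrable_weight_mul hm hu (integrable_sub_sq v₁ f)
  have h2 := integrable_weight_mul (w := fun x => 1 - u x) (aestronglyMeasurable_const.sub hm) hu'
    (integrable_sub_sq v₂ f)
  have h12 : Integrable (fun x => u x * (v₁ x - f x) ^ 2 + (1 - u x) * (v₂ x - f x) ^ 2) muΩ :=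
    h1.add h2
  rw [Feps, hI, add_zero, ← ofReal_integral_eq_lintegral_ofReal h12,
    ← ENNReal.ofReal_mul hlam, integral_add h1 h2]
  · rfl
  · filter_upwards [hu, hu'] with x hx hx'
    exact add_nonneg (mul_nonneg hx.1 (sq_nonneg _)) (mul_nonneg hx'.1 (sq_nonneg _))

lemma mem_Icc_of_Feps_ne_top {lam ε : ℝ} {f u v₁ v₂ : L2Ω} (h : Feps lam ε f u v₁ v₂ ≠ ⊤) :
    ∀ᵐ x ∂muΩ, u x ∈ Icc (0 : ℝ) 1 := by
  have hI : ∫⁻ x, indicator01 (u x) ∂muΩ ≠ ⊤ := fun h' => h (by rw [Feps, h', add_top])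
  have hmeas : Measurable indicator01 :=
    Measurable.ite measurableSet_Icc measurable_const measurable_const
  filter_upwards [ae_lt_top' (hmeas.comp_aemeasurable (Lp.aestronglyMeasurable u).aemeasurable) hI]
    with x hx
  by_contra hx'
  simp only [Function.comp_apply, indicator01, if_neg hx', lt_self_iff_false] at hx

lemma IsMinimizer.Feps_ne_top {lam ε : ℝ} (hlam : 0 ≤ lam) {f u v₁ v₂ : L2Ω}
    (hmin : IsMinimizer lam ε f u v₁ v₂) : Feps lam ε f u v₁ v₂ ≠ ⊤ := by
  refine ne_top_of_le_ne_top ?_ (hmin (constL2 0) (constL2 0) (constL2 0))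
  rw [Feps_eq lam ε hlam f ((coeFn_constL2 0).mono fun x hx => by simp [hx])]
  simp [totalVariation_constL2]

/-- Competitors keep the same `u`, so its finite variation cancels and the rest can be compared in
`ℝ`. -/
lemma IsMinimizer.real_le {lam ε : ℝ} (hlam : 0 ≤ lam) (hε : 0 < ε) {f u v₁ v₂ : L2Ω}
    (hmin : IsMinimizer lam ε f u v₁ v₂) {w₁ w₂ : L2Ω} (hw₁ : totalVariation w₁ ≠ ⊤)
    (hw₂ : totalVariation w₂ ≠ ⊤) :
    (totalVariation v₁ ≠ ⊤ ∧ totalVariation v₂ ≠ ⊤) ∧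
    1 / ε * ((totalVariation v₁).toReal + (totalVariation v₂).toReal) + lam * fidelity f u v₁ v₂ ≤
    1 / ε * ((totalVariation w₁).toReal + (totalVariation w₂).toReal) + lam * fidelity f u w₁ w₂ := by
  have hfin := hmin.Feps_ne_top hlam
  have hu := mem_Icc_of_Feps_ne_top hfin
  have hle := hmin u w₁ w₂
  have hε' : 0 < 1 / ε := by positivity
  rw [Feps_eq lam ε hlam f hu] at hfin hle
  rw [Feps_eq lam ε hlam f hu] at hle
  have htu : totalVariation u ≠ ⊤ := fun h => hfin (by simp [h])
  have hv : totalVariation v₁ + totalVariation v₂ ≠ ⊤ := fun h => hfin (by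
    rw [h, ENNReal.mul_top (by simpa using hε), add_top, top_add])
  have hv' := ENNReal.add_ne_top.1 hv
  refine ⟨hv', ?_⟩
  rw [add_assoc, add_assoc, ENNReal.add_le_add_iff_left htu] at hle
  have hmt : ∀ {a b : ℝ≥0∞}, a ≠ ⊤ → b ≠ ⊤ → ENNReal.ofReal (1 / ε) * (a + b) ≠ ⊤ :=
    fun ha hb => ENNReal.mul_ne_top ENNReal.ofReal_ne_top (ENNReal.add_ne_top.2 ⟨ha, hb⟩)
  have := ENNReal.toReal_mono
    (ENNReal.add_ne_top.2 ⟨hmt hw₁ hw₂, ENNReal.ofReal_ne_top⟩) hle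
  rwa [ENNReal.toReal_add (hmt hv'.1 hv'.2) ENNReal.ofReal_ne_top,
    ENNReal.toReal_add (hmt hw₁ hw₂) ENNReal.ofReal_ne_top, ENNReal.toReal_mul,
    ENNReal.toReal_mul, ENNReal.toReal_add hv'.1 hv'.2, ENNReal.toReal_add hw₁ hw₂,
    ENNReal.toReal_ofReal hε'.le, ENNReal.toReal_ofReal (mul_nonneg hlam (fidelity_nonneg f hu _ _)),
    ENNReal.toReal_ofReal (mul_nonneg hlam (fidelity_nonneg f hu _ _))] at this

lemma integral_mul_constL2_sub_sq (w : ℝ → ℝ) (f : L2Ω) (c : ℝ) :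
    ∫ x, w x * (constL2 c x - f x) ^ 2 ∂muΩ = ∫ x, w x * (c - f x) ^ 2 ∂muΩ := by
  refine integral_congr_ae ?_
  filter_upwards [coeFn_constL2 c] with x hx
  rw [hx]

end Segmentation

theorem theorem1 (lam ε : ℝ) (hlam : 0 < lam) (hε : 0 < ε) (hsmall : ε < 1 / (4 * lam))
    (f : Segmentation.L2Ω) (hf : ∀ᵐ x ∂Segmentation.muΩ, f x ∈ Set.Icc (0 : ℝ) 1)
    (u v₁ v₂ : Segmentation.L2Ω) (hmin : Segmentation.IsMinimizer lam ε f u v₁ v₂) :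
    ∃ c₁ c₂ : ℝ,
      (∀ᵐ x ∂Segmentation.muΩ, v₁ x = c₁) ∧
      (∀ᵐ x ∂Segmentation.muΩ, v₂ x = c₂) ∧
      (¬ (∀ᵐ x ∂Segmentation.muΩ, u x = 0) →
        c₁ = (∫ x, u x * f x ∂Segmentation.muΩ) / ∫ x, u x ∂Segmentation.muΩ) ∧
      (¬ (∀ᵐ x ∂Segmentation.muΩ, u x = 1) →
        c₂ = (∫ x, (1 - u x) * f x ∂Segmentation.muΩ) /
          ∫ x, (1 - u x) ∂Segmentation.muΩ) := by
  open Segmentation in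
  have hu := mem_Icc_of_Feps_ne_top (hmin.Feps_ne_top hlam.le)
  have hum := Lp.aestronglyMeasurable u
  have hconst : ∀ c, totalVariation (constL2 c) ≠ ⊤ := fun c => by simp [totalVariation_constL2]
  -- The competitor is arbitrary here: only finiteness of the variations is extracted.
  have hv := (hmin.real_le hlam.le hε (hconst 0) (hconst 0)).1
  obtain ⟨c₁, h₁, h₁'⟩ := const_of_le_const hlam hε hsmall hum hu hf hv.1 (fun c => by
    have := (hmin.real_le hlam.le hε (hconst c) hv.2).2
    simp only [fidelity, integral_mul_constL2_sub_sq u, totalVariation_constL2,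
      ENNReal.toReal_zero] at this
    linarith)
  obtain ⟨c₂, h₂, h₂'⟩ := const_of_le_const hlam hε hsmall (w := fun x => 1 - u x)
    (aestronglyMeasurable_const.sub hum)
    (one_sub_mem_Icc hu) hf hv.2 (fun c => by
    have := (hmin.real_le hlam.le hε hv.1 (hconst c)).2
    simp only [fidelity, integral_mul_constL2_sub_sq (fun x => 1 - u x), totalVariation_constL2,
      ENNReal.toReal_zero] at this
    linarith)
  exact ⟨c₁, c₂, h₁, h₂, h₁', fun h => h₂' fun h' => h (h'.mono fun x hx => by linarith)⟩
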